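/- Let $\mathcal X$ be an input space, let $\mathcal Y\subseteq\mathbb R$ be a set of labels (for instance $\mathcal Y=[-1,1]$), and put $\mathcal Z=\mathcal X\times\mathcal Y$. Let $\mathcal F$ be a class of functions $\mathcal X\to\mathbb R$ that is uniformly bounded: $\sup_{f\in\mathcal F,\,x\in\mathcal X}|f(x)|<\infty$. A complete binary tree $\mathbf a$ of depth $n$ with labels in a set $A$ is a sequence of maps $\mathbf a_t:\{\pm1\}^{t-1}\to A$, $1\le t\le n$. For $\gamma>0$, the sequential fat-shattering dimension $\mathrm{sfat}_\gamma(\mathcal F)\in\{0,1,2,\dots\}\cup\{\infty\}$ is the supremum of the depths $n$ of $\mathcal X$-labelled trees $\mathbf x$ for which there is a real-labelled tree $\mathbf s$ of the same depth such that $$\forall\,\epsilon_{1:n}\in\{\pm1\}^n\ \exists f\in\mathcal F\ \forall\,1\le t\le n:\quad \epsilon_t\bigl(f(\mathbf x_t(\epsilon_{1:t-1}))-\mathbf s_t(\epsilon_{1:t-1})\bigr)\ge\gamma .$$ Let $\ell((x,y),f)=|y-f(x)|$ be the absolute loss. The sequential Rademacher complexity of the loss class $\ell\circ\mathcal F=\{z\mapsto\ell(z,f):f\in\mathcal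 F\}$ is $$\mathfrak R^{\mathrm{seq}}_n(\ell\circ\mathcal F)=\sup_{\mathbf z}\ \mathbb E\left[\sup_{f\in\mathcal F}\frac1n\sum_{t=1}^n\epsilon_t\,\ell(\mathbf z_t(\epsilon_{1:t-1}),f)\right],$$ where the outer supremum is over all $\mathcal Z$-labelled trees of depth $n$, the expectation is over independent uniform signs $\epsilon_1,\dots,\epsilon_n\in\{\pm1\}$, and suprema are taken in $[-\infty,\infty]$. Theorem. If $\mathrm{sfat}_\gamma(\mathcal F)<\infty$ for every $\gamma>0$, then $$\limsup_{n\to\infty}\mathfrak R^{\mathrm{seq}}_n(\ell\circ\mathcal F)\le 0 .$$ Moreover, if $\mathcal X$, $\mathcal Y$ and $\mathcal F$ are nonempty, then $\mathfrak R^{\mathrm{seq}}_n(\ell\circ\mathcal F)\to0$ as $n\to\infty$. -/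

import Mathlib

open Filter Topology

noncomputable section

namespace SeqLearning

/-- A complete binary tree of depth `n` with labels in `A`: for each level `t` (levels are
numbered from `0`) a map sending the sign path `ε₀, …, ε_{t-1}` leading to a node of that level
to the label of the node. Signs are elements of `ℤˣ = {1, -1}`. -/
abbrev SignTree (A : Type*) (n : ℕ) : Type _ :=
  (t : Fin n) → (Fin (t : ℕ) → ℤˣ) → A

/-- The label at level `t` of the node that is reached along the sign sequence `ε`. -/
def SignTree.label {A : Type*} {n : ℕ} (x : SignTree A n) (ε : Fin n → ℤˣ) (t : Fin n) : A :=
  x t (fun i => ε (Fin.castLE t.isLt.le i))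

/-- A tree `x` is `γ`-shattered by the class `F` if there is a real-valued witness tree `s` such
that every sign sequence `ε` is realized, with margin `γ`, by some `f ∈ F` along the path `ε`. -/
def GammaShattered {X : Type*} {n : ℕ} (γ : ℝ) (F : Set (X → ℝ)) (x : SignTree X n) : Prop :=
  ∃ s : SignTree ℝ n, ∀ ε : Fin n → ℤˣ, ∃ f ∈ F, ∀ t : Fin n,
    γ ≤ ((ε t : ℤ) : ℝ) * (f (x.label ε t) - s.label ε t)

/-- The sequential fat-shattering dimension of `F` at scale `γ`: the largest depth of a
`γ`-shattered tree (`⊤` if there are such trees of arbitrarily large depth). -/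
def sfat {X : Type*} (γ : ℝ) (F : Set (X → ℝ)) : ℕ∞ :=
  ⨆ (n : ℕ) (_ : ∃ x : SignTree X n, GammaShattered γ F x), (n : ℕ∞)

/-- The sequential Rademacher complexity of a class `G` on a given tree `z` of depth `n`. The
expectation over independent uniform signs is the average over the `2 ^ n` sign sequences. -/
def seqRadTree {Z : Type*} {n : ℕ} (G : Set (Z → ℝ)) (z : SignTree Z n) : EReal :=
  ((((2 : ℝ) ^ n)⁻¹ : ℝ) : EReal) * ∑ ε : Fin n → ℤˣ,
    ⨆ g ∈ G, (((1 / (n : ℝ)) * ∑ t : Fin n, ((ε t : ℤ) : ℝ) * g (z.label ε t) : ℝ) : EReal)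

/-- The sequential Rademacher complexity of a class `G`: the supremum over all trees of
depth `n`. -/
def seqRad {Z : Type*} (n : ℕ) (G : Set (Z → ℝ)) : EReal :=
  ⨆ z : SignTree Z n, seqRadTree G z

/-- The absolute loss of the predictor `f` on an input-output pair. -/
def absLoss {X : Type*} {Y : Set ℝ} (z : X × Y) (f : X → ℝ) : ℝ :=
  |(z.2 : ℝ) - f z.1|

/-- The loss class `{z ↦ ℓ(z, f) : f ∈ F}`. -/
def lossClass {X Z : Type*} (ℓ : Z → (X → ℝ) → ℝ) (F : Set (X → ℝ)) : Set (Z → ℝ) :=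
  {g | ∃ f ∈ F, g = fun z => ℓ z f}

end SeqLearning

end

/-! A near-maximizer `φ ε ∈ F` is chosen for each sign path, and the exponential moment of its
signed loss is bounded by recursion on the tree, in the spirit of Littlestone and Sauer–Shelah. Cut
`F` at the root into slices of width `2 * γ`. If no tree of depth `D + 1` is shattered, the slices
that still shatter depth `D` are pairwise adjacent (`le_add_one_of_gammaShattered_slice`), so their
union varies by at most `4 * γ` at the root. Each of the at most `k` other slices has lost one unit
of dimension. On either kind of piece the root term is nearly a fixed number times a sign, and costs
`exp (l * (4 * γ) + l ^ 2 * M ^ 2 / 2)`. Hence `expMoment_le`: the growth is only polynomial in `n`,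
of degree `D`. Taking logarithms leaves `D * log (1 + k * n) / (l * n) + 4 * γ + l * B ^ 2 / 2`,
which is small for `γ`, then `l`, small and `n` large. -/

namespace SeqLearning

/-! ### Recursive structure of sign trees -/

section Trees

variable {A B : Type*} {n : ℕ}

/-- The subtree hanging below the root of `z` in the direction `s`. -/
def SignTree.sub (z : SignTree A (n + 1)) (s : ℤˣ) : SignTree A n :=
  fun t p => z t.succ (Fin.cons (α := fun _ => ℤˣ) s p)

/-- The tree with a given root label and given subtrees in the two directions. -/
def SignTree.node (a : A) (u : ℤˣ → SignTree A n) : SignTree A (n + 1) :=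
  fun t => Fin.cases (motive := fun t : Fin (n + 1) => (Fin (t : ℕ) → ℤˣ) → A)
    (fun _ => a) (fun t (p : Fin ((t : ℕ) + 1) → ℤˣ) => u (p 0) t (fun i => p i.succ)) t

/-- Relabelling a tree. -/
def SignTree.map (f : A → B) (z : SignTree A n) : SignTree B n := fun t p => f (z t p)

lemma SignTree.label_map (f : A → B) (z : SignTree A n) (ε : Fin n → ℤˣ) (t : Fin n) :
    (z.map f).label ε t = f (z.label ε t) := rfl

lemma SignTree.label_zero (z : SignTree A (n + 1)) (ε : Fin (n + 1) → ℤˣ) :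
    z.label ε 0 = z 0 Fin.elim0 := by
  unfold SignTree.label
  congr 1
  funext i
  exact i.elim0

lemma SignTree.label_cons_succ (z : SignTree A (n + 1)) (s : ℤˣ) (ε : Fin n → ℤˣ) (t : Fin n) :
    z.label (Fin.cons (α := fun _ => ℤˣ) s ε) t.succ = (z.sub s).label ε t := by
  unfold SignTree.label SignTree.sub
  congr 1
  funext i
  refine Fin.cases ?_ (fun j => ?_) i <;> rfl

lemma sum_signs_succ {M : Type*} [AddCommMonoid M] (g : (Fin (n + 1) → ℤˣ) → M) :
    ∑ ε, g ε = ∑ s : ℤˣ, ∑ ε : Fin n → ℤˣ, g (Fin.cons (α := fun _ => ℤˣ) s ε) := by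
  rw [← Fintype.sum_prod_type']
  exact (Fintype.sum_equiv (Fin.consEquiv (fun _ => ℤˣ)) _ _ (fun _ => rfl)).symm

lemma sum_units_int {M : Type*} [AddCommMonoid M] (g : ℤˣ → M) : ∑ s, g s = g 1 + g (-1) := by
  rw [UnitsInt.univ, Finset.sum_pair (by decide)]

/-- Predictable linear forms in independent signs are centred. -/
lemma sum_signs_mul_label (a : SignTree ℝ n) :
    ∑ ε : Fin n → ℤˣ, ∑ t, ((ε t : ℤ) : ℝ) * a.label ε t = 0 := by
  induction n with
  | zero => simp
  | succ n ih =>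
    rw [sum_signs_succ, sum_units_int]
    simp only [Fin.sum_univ_succ, Finset.sum_add_distrib, Fin.cons_zero, Fin.cons_succ,
      SignTree.label_zero, SignTree.label_cons_succ, ih]
    simp

end Trees

/-! ### Shattering and slices at the root -/

section Shattering

variable {X : Type*} {n : ℕ} {γ : ℝ} {F G : Set (X → ℝ)}

lemma GammaShattered.mono (h : F ⊆ G) {x : SignTree X n} (hx : GammaShattered γ F x) :
    GammaShattered γ G x := by
  obtain ⟨s, hs⟩ := hx
  refine ⟨s, fun ε => ?_⟩
  obtain ⟨f, hf, hft⟩ := hs ε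
  exact ⟨f, h hf, hft⟩

lemma GammaShattered.node {c : ℝ} {a : X} {x : ℤˣ → SignTree X n} {P : ℤˣ → Set (X → ℝ)}
    (hP : ∀ s, P s ⊆ F) (hx : ∀ s, GammaShattered γ (P s) (x s))
    (hr : ∀ s, ∀ f ∈ P s, γ ≤ ((s : ℤ) : ℝ) * (f a - c)) :
    GammaShattered γ F (SignTree.node a x) := by
  choose w hw using hx
  refine ⟨SignTree.node c w, fun ε => ?_⟩
  obtain ⟨f, hf, hft⟩ := hw (ε 0) (fun i => ε i.succ)
  refine ⟨f, hP _ hf, fun t => ?_⟩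
  refine Fin.cases ?_ (fun t => ?_) t
  · exact hr _ f hf
  · exact hft t

lemma exists_not_gammaShattered (h : sfat γ F < ⊤) :
    ∃ D : ℕ, ∀ x : SignTree X D, ¬ GammaShattered γ F x := by
  obtain ⟨D, hD⟩ := ENat.ne_top_iff_exists.1 h.ne
  refine ⟨D + 1, fun x hx => ?_⟩
  have h1 : ((D + 1 : ℕ) : ℕ∞) ≤ sfat γ F :=
    le_iSup₂_of_le (f := fun (n : ℕ) (_ : ∃ x : SignTree X n, GammaShattered γ F x) => (n : ℕ∞))
      (D + 1) ⟨x, hx⟩ le_rfl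
  rw [← hD] at h1
  have : D + 1 ≤ D := by exact_mod_cast h1
  omega

/-- The functions of `F` whose value at `a` lies in the `j`-th interval of length `2 * γ`. -/
def slice (γ : ℝ) (F : Set (X → ℝ)) (a : X) (j : ℤ) : Set (X → ℝ) :=
  {f ∈ F | ⌊f a / (2 * γ)⌋ = j}

lemma slice_subset (a : X) (j : ℤ) : slice γ F a j ⊆ F := fun _ h => h.1

lemma slice_bounds (hγ : 0 < γ) {a : X} {j : ℤ} {f : X → ℝ} (hf : f ∈ slice γ F a j) :
    j * (2 * γ) ≤ f a ∧ f a < (j + 1) * (2 * γ) := by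
  have h := Int.floor_eq_iff.1 hf.2
  rw [le_div_iff₀ (by positivity), div_lt_iff₀ (by positivity)] at h
  exact h

/-- Two slices that both shatter trees of depth `D` are adjacent, unless the whole class shatters
a tree of depth `D + 1`. -/
lemma le_add_one_of_gammaShattered_slice (hγ : 0 < γ)
    (hF : ∀ x : SignTree X (n + 1), ¬ GammaShattered γ F x) {a : X} {i j : ℤ}
    (hi : ∃ x : SignTree X n, GammaShattered γ (slice γ F a i) x)
    (hj : ∃ x : SignTree X n, GammaShattered γ (slice γ F a j) x) : j ≤ i + 1 := by
  by_contra! hlt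
  obtain ⟨u, hu⟩ := hi
  obtain ⟨v, hv⟩ := hj
  have hij : (i : ℝ) + 2 ≤ j := by exact_mod_cast (by omega : i + 2 ≤ j)
  -- The threshold is the midpoint of the gap between slices `i` and `i + 2`; it is at distance `γ`
  -- from both.
  refine hF _ (GammaShattered.node (a := a) (c := (i + 3 / 2) * (2 * γ))
    (x := fun s => if s = 1 then v else u)
    (P := fun s => slice γ F a (if s = 1 then j else i)) (fun s => slice_subset _ _) ?_ ?_)
  · intro s
    by_cases hs : s = 1 <;> simp [hs, hu, hv]
  · intro s f hf
    have hb := slice_bounds hγ hf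
    rcases Int.units_eq_one_or s with rfl | rfl
    · simp only [if_true] at hb
      simp only [Units.val_one, Int.cast_one, one_mul]
      nlinarith [hb.1]
    · rw [if_neg (by decide)] at hb
      simp only [Units.val_neg, Units.val_one, Int.cast_neg, Int.cast_one]
      nlinarith [hb.2]

end Shattering

/-! ### Exponential moments along a tree -/

section ExponentialMoment

open Classical in
/-- The sum over all sign sequences `ε` with `φ ε ∈ F` of the exponential of `l` times the signed
sum of the values `h z (φ ε)` along the tree. -/
noncomputable def expMoment {X Z : Type*} {n : ℕ} (π : Z → X) (h : Z → ℝ → ℝ) (l : ℝ) (F : Set (X → ℝ))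
    (z : SignTree Z n) (φ : (Fin n → ℤˣ) → X → ℝ) : ℝ :=
  ∑ ε, if φ ε ∈ F then
    Real.exp (l * ∑ t, ((ε t : ℤ) : ℝ) * h (z.label ε t) (φ ε (π (z.label ε t)))) else 0

variable {X Z : Type*} {n : ℕ} {π : Z → X} {h : Z → ℝ → ℝ} {l w M K : ℝ} {F P : Set (X → ℝ)}

/-- One step of the recursion, for a class that is almost constant at the root. -/
lemma expMoment_succ_le (hl : 0 ≤ l) (hK : 0 ≤ K)
    (hlip : ∀ z u v, |h z u - h z v| ≤ |u - v|)
    (hM : ∀ f ∈ P, ∀ z, |h z (f (π z))| ≤ M) {z : SignTree Z (n + 1)}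
    (hw : ∀ f ∈ P, ∀ g ∈ P, |f (π (z 0 Fin.elim0)) - g (π (z 0 Fin.elim0))| ≤ w)
    (hsub : ∀ (u : SignTree Z n) ψ, expMoment π h l P u ψ ≤ 2 ^ n * K)
    (φ : (Fin (n + 1) → ℤˣ) → X → ℝ) :
    expMoment π h l P z φ ≤ 2 ^ (n + 1) * (K * Real.exp (l * w + l ^ 2 * M ^ 2 / 2)) := by
  classical
  rcases P.eq_empty_or_nonempty with rfl | ⟨f₀, hf₀⟩
  · simp only [expMoment, Set.mem_empty_iff_false, if_false, Finset.sum_const_zero]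
    positivity
  set z₀ := z 0 Fin.elim0 with hz₀
  -- Replacing the root value by that of the fixed `f₀` costs a factor `exp (l * w)`; what remains
  -- at the root, summed over the sign, is `2 * cosh (l * c)`.
  set c := h z₀ (f₀ (π z₀)) with hc
  have key : ∀ s : ℤˣ, ∑ ε : Fin n → ℤˣ, (if φ (Fin.cons (α := fun _ => ℤˣ) s ε) ∈ P then
      Real.exp (l * ∑ t, (((Fin.cons (α := fun _ => ℤˣ) s ε : Fin (n + 1) → ℤˣ) t : ℤ) : ℝ) *
        h (z.label (Fin.cons (α := fun _ => ℤˣ) s ε) t)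
          (φ (Fin.cons (α := fun _ => ℤˣ) s ε)
            (π (z.label (Fin.cons (α := fun _ => ℤˣ) s ε) t)))) else 0)
      ≤ Real.exp (l * w) * Real.exp (((s : ℤ) : ℝ) * (l * c)) * (2 ^ n * K) := by
    intro s
    refine le_trans ?_ (mul_le_mul_of_nonneg_left
      (hsub (z.sub s) (fun ε => φ (Fin.cons (α := fun _ => ℤˣ) s ε))) (by positivity))
    rw [expMoment, Finset.mul_sum]
    refine Finset.sum_le_sum fun ε _ => ?_
    split_ifs with hφ
    · rw [← Real.exp_add, ← Real.exp_add]
      apply Real.exp_le_exp.2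
      simp only [Fin.sum_univ_succ, Fin.cons_zero, Fin.cons_succ, SignTree.label_zero,
        SignTree.label_cons_succ, mul_add]
      have h1 : |h z₀ (φ (Fin.cons (α := fun _ => ℤˣ) s ε) (π z₀)) - c| ≤ w :=
        (hlip _ _ _).trans (hw _ hφ _ hf₀)
      have h2 : ((s : ℤ) : ℝ) * h z₀ (φ (Fin.cons (α := fun _ => ℤˣ) s ε) (π z₀)) ≤
          w + ((s : ℤ) : ℝ) * c := by
        rw [abs_le] at h1
        rcases Int.units_eq_one_or s with rfl | rfl <;> simp <;> linarith
      have h3 := mul_le_mul_of_nonneg_left h2 hl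
      linarith
    · simp
  have hcosh : Real.exp (l * c) + Real.exp (-(l * c)) ≤ 2 * Real.exp (l ^ 2 * M ^ 2 / 2) := by
    have h1 := Real.cosh_le_exp_half_sq (l * c)
    rw [Real.cosh_eq] at h1
    have h2 : Real.exp ((l * c) ^ 2 / 2) ≤ Real.exp (l ^ 2 * M ^ 2 / 2) := by
      apply Real.exp_le_exp.2
      have : c ^ 2 ≤ M ^ 2 := sq_le_sq' (abs_le.1 (hM _ hf₀ z₀)).1 (abs_le.1 (hM _ hf₀ z₀)).2
      rw [mul_pow]
      gcongr
    linarith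
  rw [expMoment, sum_signs_succ, sum_units_int]
  refine (add_le_add (key 1) (key (-1))).trans ?_
  simp only [Units.val_one, Units.val_neg, Int.cast_one, Int.cast_neg, one_mul, neg_mul]
  calc _ = Real.exp (l * w) * (2 ^ n * K) * (Real.exp (l * c) + Real.exp (-(l * c))) := by ring
    _ ≤ Real.exp (l * w) * (2 ^ n * K) * (2 * Real.exp (l ^ 2 * M ^ 2 / 2)) := by gcongr
    _ = _ := by rw [Real.exp_add]; ring

/-- Exponential moment bound for a class with finite sequential fat-shattering dimension. -/
theorem expMoment_le {γ B : ℝ} (hγ : 0 < γ) (hl : 0 ≤ l)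
    (hlip : ∀ z u v, |h z u - h z v| ≤ |u - v|) (hM : ∀ z v, |v| ≤ B → |h z v| ≤ M)
    {N : ℕ} (hN : B / (2 * γ) ≤ N) :
    ∀ (n D : ℕ) (F : Set (X → ℝ)), (∀ f ∈ F, ∀ x, |f x| ≤ B) →
      (∀ x : SignTree X D, ¬ GammaShattered γ F x) →
      ∀ (z : SignTree Z n) (φ : (Fin n → ℤˣ) → X → ℝ),
      expMoment π h l F z φ ≤ 2 ^ n * ((1 + ((2 * N + 1 : ℕ) : ℝ) * n) ^ D *
        Real.exp (n * (l * (4 * γ) + l ^ 2 * M ^ 2 / 2))) := by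
  classical
  intro n
  induction n with
  | zero =>
    intro D F _ _ z φ
    simp only [expMoment]
    refine (Finset.sum_le_sum (g := fun _ => (1 : ℝ)) fun ε _ => ?_).trans ?_
    · split_ifs <;> simp
    · simp
  | succ n ih =>
    intro D F hB hD z φ
    set k : ℕ := 2 * N + 1 with hk
    set e := Real.exp (l * (4 * γ) + l ^ 2 * M ^ 2 / 2) with he
    set q : ℝ := 1 + (k : ℝ) * n with hq
    set E := Real.exp (n * (l * (4 * γ) + l ^ 2 * M ^ 2 / 2)) with hE
    have hq0 : 0 ≤ q := by positivity
    cases D with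
    | zero =>
      -- The tree of depth `0` is shattered by any nonempty class.
      have hF : F = ∅ := by
        by_contra hne
        obtain ⟨f, hf⟩ := Set.nonempty_iff_ne_empty.2 hne
        exact hD (fun t => t.elim0) ⟨fun t => t.elim0, fun ε => ⟨f, hf, fun t => t.elim0⟩⟩
      subst hF
      simp only [expMoment, Set.mem_empty_iff_false, if_false, Finset.sum_const_zero]
      positivity
    | succ D =>
      set a := π (z 0 Fin.elim0) with ha
      set J : Set ℤ := {j | ∃ x : SignTree X D, GammaShattered γ (slice γ F a j) x} with hJ
      set Q : Set (X → ℝ) := {f ∈ F | ⌊f a / (2 * γ)⌋ ∈ J} with hQ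
      set I : Finset ℤ := (Finset.Icc (-(N : ℤ)) N).filter (· ∉ J) with hI
      have hself : ∀ f ∈ F, f ∈ slice γ F a ⌊f a / (2 * γ)⌋ := fun f hf => ⟨hf, rfl⟩
      have hQF : Q ⊆ F := fun _ hf => hf.1
      have hQb : expMoment π h l Q z φ ≤ 2 ^ (n + 1) * (q ^ (D + 1) * E * e) := by
        refine expMoment_succ_le hl (by positivity) hlip
          (fun f hf z => hM _ _ (hB f (hQF hf) _)) ?_
          (fun u ψ => ih (D + 1) Q (fun f hf => hB f (hQF hf))
            (fun x hx => hD x (hx.mono hQF)) u ψ) φ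
        intro f hf g hg
        have h1 := le_add_one_of_gammaShattered_slice hγ hD hf.2 hg.2
        have h2 := le_add_one_of_gammaShattered_slice hγ hD hg.2 hf.2
        have h3 := slice_bounds hγ (hself f hf.1)
        have h4 := slice_bounds hγ (hself g hg.1)
        have h1' : ((⌊g a / (2 * γ)⌋ : ℤ) : ℝ) ≤ ⌊f a / (2 * γ)⌋ + 1 := by exact_mod_cast h1
        have h2' : ((⌊f a / (2 * γ)⌋ : ℤ) : ℝ) ≤ ⌊g a / (2 * γ)⌋ + 1 := by exact_mod_cast h2
        rw [abs_le]
        constructor <;> nlinarith [h3.1, h3.2, h4.1, h4.2]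
      have hIb : ∀ j ∈ I, expMoment π h l (slice γ F a j) z φ ≤
          2 ^ (n + 1) * (q ^ D * E * e) := by
        intro j hj
        have hjJ : j ∉ J := (Finset.mem_filter.1 hj).2
        refine expMoment_succ_le hl (by positivity) hlip
          (fun f hf z => hM _ _ (hB f hf.1 _)) ?_
          (fun u ψ => ih D _ (fun f hf => hB f hf.1) (fun x hx => hjJ ⟨x, hx⟩) u ψ) φ
        intro f hf g hg
        have h3 := slice_bounds hγ hf
        have h4 := slice_bounds hγ hg
        rw [abs_le]
        constructor <;> nlinarith [h3.1, h3.2, h4.1, h4.2]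
      -- Each selected function lies in `Q` or in a slice indexed by `I`, since `B ≤ N * (2 * γ)`
      -- keeps the slice indices in `[-N, N]`.
      have hsplit : expMoment π h l F z φ ≤
          expMoment π h l Q z φ + ∑ j ∈ I, expMoment π h l (slice γ F a j) z φ := by
        simp only [expMoment]
        rw [Finset.sum_comm, ← Finset.sum_add_distrib]
        refine Finset.sum_le_sum fun ε _ => ?_
        set v := Real.exp (l * ∑ t, ((ε t : ℤ) : ℝ) * h (z.label ε t) (φ ε (π (z.label ε t))))
        have hv : 0 ≤ v := (Real.exp_pos _).le
        have hnn : ∀ p : Prop, 0 ≤ (if p then v else 0) := fun p => by split_ifs <;> simp [hv]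
        by_cases hF : φ ε ∈ F
        · rw [if_pos hF]
          by_cases hj : ⌊φ ε a / (2 * γ)⌋ ∈ J
          · rw [if_pos (show φ ε ∈ Q from ⟨hF, hj⟩)]
            exact le_add_of_nonneg_right (Finset.sum_nonneg fun j _ => hnn _)
          · have hmem : ⌊φ ε a / (2 * γ)⌋ ∈ I := by
              have hb := abs_le.1 (hB _ hF a)
              have hN' : B ≤ N * (2 * γ) := (div_le_iff₀ (by positivity)).1 hN
              refine Finset.mem_filter.2 ⟨Finset.mem_Icc.2 ⟨?_, ?_⟩, hj⟩
              · rw [Int.le_floor, le_div_iff₀ (by positivity)]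
                push_cast
                linarith [hb.1]
              · have : ((⌊φ ε a / (2 * γ)⌋ : ℤ) : ℝ) ≤ N := by
                  refine (Int.floor_le _).trans ?_
                  rw [div_le_iff₀ (by positivity)]
                  linarith [hb.2]
                exact_mod_cast this
            refine le_trans ?_ (le_add_of_nonneg_left (hnn _))
            refine le_trans ?_ (Finset.single_le_sum (fun j _ => hnn _) hmem)
            rw [if_pos (hself _ hF)]
        · rw [if_neg hF]
          exact add_nonneg (hnn _) (Finset.sum_nonneg fun j _ => hnn _)
      have hcard : (I.card : ℝ) ≤ k := by
        have h1 : I.card ≤ k := by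
          refine (Finset.card_filter_le _ _).trans ?_
          rw [Int.card_Icc]
          omega
        exact_mod_cast h1
      have hexp : Real.exp ((n + 1 : ℕ) * (l * (4 * γ) + l ^ 2 * M ^ 2 / 2)) = E * e := by
        rw [hE, he, ← Real.exp_add]
        congr 1
        push_cast
        ring
      have hq' : 1 + (k : ℝ) * ((n + 1 : ℕ) : ℝ) = q + k := by
        rw [hq]
        push_cast
        ring
      rw [hexp, hq']
      calc _ ≤ _ := hsplit
        _ ≤ 2 ^ (n + 1) * (q ^ (D + 1) * E * e) +
            ∑ _j ∈ I, 2 ^ (n + 1) * (q ^ D * E * e) :=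
          add_le_add hQb (Finset.sum_le_sum hIb)
        _ = 2 ^ (n + 1) * (q ^ (D + 1) * E * e) + I.card * (2 ^ (n + 1) * (q ^ D * E * e)) := by
          rw [Finset.sum_const, nsmul_eq_mul]
        _ ≤ 2 ^ (n + 1) * (q ^ (D + 1) * E * e) + k * (2 ^ (n + 1) * (q ^ D * E * e)) := by
          gcongr
        _ = 2 ^ (n + 1) * (q ^ D * (q + k) * (E * e)) := by ring
        _ ≤ 2 ^ (n + 1) * ((q + k) ^ (D + 1) * (E * e)) := by
          rw [pow_succ (q + k)]
          have : q ^ D ≤ (q + k) ^ D := pow_le_pow_left₀ hq0 (by simp) D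
          gcongr

/-- A mean is controlled by the logarithm of the mean of the exponential. -/
lemma sum_le_of_sum_exp_le {ι : Type*} {s : Finset ι} {u : ι → ℝ} {c : ℝ}
    (hu : ∑ i ∈ s, Real.exp (u i) ≤ s.card * Real.exp c) : ∑ i ∈ s, u i ≤ s.card * c := by
  -- Jensen's inequality by way of the tangent line of `exp` at `c`.
  have h1 : ∀ i ∈ s, u i ≤ Real.exp (u i) * Real.exp (-c) - 1 + c := fun i _ => by
    rw [← Real.exp_add]
    linarith [Real.add_one_le_exp (u i + -c)]
  refine (Finset.sum_le_sum h1).trans ?_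
  rw [Finset.sum_add_distrib, Finset.sum_sub_distrib, ← Finset.sum_mul]
  have h2 := mul_le_mul_of_nonneg_right hu (Real.exp_pos (-c)).le
  rw [mul_assoc, ← Real.exp_add, add_neg_cancel, Real.exp_zero] at h2
  simp only [Finset.sum_const, nsmul_eq_mul]
  linarith

end ExponentialMoment

/-! ### Absolute loss and the limit -/

section Loss

variable {X : Type*} {Y : Set ℝ} {F : Set (X → ℝ)} {n : ℕ}

/-- Averaged signed losses of predictors chosen with knowledge of the signs. -/
lemma sum_signed_loss_le {γ B l : ℝ} (hγ : 0 < γ) (hl : 0 < l)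
    (hB : ∀ f ∈ F, ∀ x, |f x| ≤ B) {N D : ℕ} (hN : B / (2 * γ) ≤ N)
    (hD : ∀ x : SignTree X D, ¬ GammaShattered γ F x) (hn : 0 < n)
    (z : SignTree (X × Y) n) {φ : (Fin n → ℤˣ) → X → ℝ} (hφ : ∀ ε, φ ε ∈ F) :
    ∑ ε : Fin n → ℤˣ, 1 / (n : ℝ) * ∑ t, ((ε t : ℤ) : ℝ) * absLoss (z.label ε t) (φ ε) ≤
      2 ^ n * (D / l * (Real.log (1 + ((2 * N + 1 : ℕ) : ℝ) * n) / n) +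
        4 * γ + l * B ^ 2 / 2) := by
  have hn' : (0 : ℝ) < n := by exact_mod_cast hn
  set q : ℝ := 1 + ((2 * N + 1 : ℕ) : ℝ) * n with hq
  have hq0 : 0 < q := by positivity
  -- Subtracting `|y|` makes the loss bounded by `B` even if `Y` is unbounded; the subtracted term
  -- is predictable, hence centred.
  have hm := expMoment_le (π := Prod.fst) (h := fun (z : X × Y) v => |(z.2 : ℝ) - v| - |(z.2 : ℝ)|)
    (M := B) hγ hl.le
    (fun z u v => by
      have := abs_abs_sub_abs_le_abs_sub ((z.2 : ℝ) - u) (z.2 - v)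
      rw [show (z.2 : ℝ) - u - (z.2 - v) = -(u - v) by ring, abs_neg] at this
      simpa using this)
    (fun z v hv => by
      have := abs_abs_sub_abs_le_abs_sub ((z.2 : ℝ) - v) z.2
      rw [show (z.2 : ℝ) - v - z.2 = -v by ring, abs_neg] at this
      exact this.trans hv) hN n D F hB hD z φ
  simp only [expMoment, hφ, if_true] at hm
  have hexp : q ^ D * Real.exp (n * (l * (4 * γ) + l ^ 2 * B ^ 2 / 2)) =
      Real.exp (D * Real.log q + n * (l * (4 * γ) + l ^ 2 * B ^ 2 / 2)) := by
    rw [Real.exp_add, Real.exp_nat_mul (Real.log q), Real.exp_log hq0]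
  have hcard : ((Finset.univ : Finset (Fin n → ℤˣ)).card : ℝ) = 2 ^ n := by simp
  rw [hexp, ← hcard] at hm
  have hs := sum_le_of_sum_exp_le hm
  rw [hcard, ← Finset.mul_sum] at hs
  have hzero := sum_signs_mul_label (z.map fun p => |(p.2 : ℝ)|)
  simp only [SignTree.label_map] at hzero
  simp only [mul_sub, Finset.sum_sub_distrib, hzero, sub_zero] at hs
  rw [← Finset.mul_sum]
  set S := ∑ ε : Fin n → ℤˣ, ∑ t, ((ε t : ℤ) : ℝ) * absLoss (z.label ε t) (φ ε) with hS
  have hs' : l * S ≤ 2 ^ n * (D * Real.log q + n * (l * (4 * γ) + l ^ 2 * B ^ 2 / 2)) := hs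
  calc 1 / (n : ℝ) * S = (l * S) / (l * n) := by field_simp
    _ ≤ (2 ^ n * (D * Real.log q + n * (l * (4 * γ) + l ^ 2 * B ^ 2 / 2))) / (l * n) := by gcongr
    _ = _ := by field_simp; ring

/-- Near-maximizers of the signed loss exist in a bounded class. -/
lemma exists_iSup_lossClass_le {B η : ℝ} (hη : 0 < η) (hF : F.Nonempty)
    (hB : ∀ f ∈ F, ∀ x, |f x| ≤ B) (z : SignTree (X × Y) n) (ε : Fin n → ℤˣ) :
    ∃ f ∈ F, (⨆ g ∈ lossClass (absLoss (X := X) (Y := Y)) F,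
      (((1 / (n : ℝ)) * ∑ t : Fin n, ((ε t : ℤ) : ℝ) * g (z.label ε t) : ℝ) : EReal)) ≤
      ((1 / (n : ℝ) * ∑ t, ((ε t : ℤ) : ℝ) * absLoss (z.label ε t) f + η : ℝ) : EReal) := by
  set val : (X → ℝ) → ℝ := fun f =>
    1 / (n : ℝ) * ∑ t, ((ε t : ℤ) : ℝ) * absLoss (z.label ε t) f with hval
  have hbdd : BddAbove (val '' F) := by
    refine ⟨1 / (n : ℝ) * ∑ t, (|((z.label ε t).2 : ℝ)| + B), ?_⟩
    rintro _ ⟨f, hf, rfl⟩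
    refine mul_le_mul_of_nonneg_left (Finset.sum_le_sum fun t _ => ?_) (by positivity)
    have h1 : |((ε t : ℤ) : ℝ)| = 1 := by
      rcases Int.units_eq_one_or (ε t) with h | h <;> simp [h]
    calc ((ε t : ℤ) : ℝ) * absLoss (z.label ε t) f
        ≤ |((ε t : ℤ) : ℝ) * absLoss (z.label ε t) f| := le_abs_self _
      _ = absLoss (z.label ε t) f := by rw [abs_mul, h1, one_mul, absLoss, abs_abs]
      _ ≤ |((z.label ε t).2 : ℝ)| + |f (z.label ε t).1| := abs_sub _ _
      _ ≤ _ := by linarith [hB f hf (z.label ε t).1]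
  obtain ⟨_, ⟨f, hf, rfl⟩, hlt⟩ :=
    exists_lt_of_lt_csSup (hF.image val) (sub_lt_self (sSup (val '' F)) hη)
  refine ⟨f, hf, iSup₂_le ?_⟩
  rintro _ ⟨g, hg, rfl⟩
  have := le_csSup hbdd (Set.mem_image_of_mem val hg)
  exact EReal.coe_le_coe_iff.2 (show val g ≤ val f + η by linarith)

lemma coe_sum_ereal {ι : Type*} (s : Finset ι) (u : ι → ℝ) :
    ((∑ i ∈ s, u i : ℝ) : EReal) = ∑ i ∈ s, (u i : EReal) :=
  map_sum (⟨⟨Real.toEReal, EReal.coe_zero⟩, EReal.coe_add⟩ : ℝ →+ EReal) u s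

/-- Any single `f ∈ F` already has centred signed losses, and the supremum dominates it. -/
lemma seqRadTree_nonneg (hF : F.Nonempty) (z : SignTree (X × Y) n) :
    0 ≤ seqRadTree (lossClass (absLoss (X := X) (Y := Y)) F) z := by
  obtain ⟨f, hf⟩ := hF
  refine mul_nonneg (EReal.coe_nonneg.2 (by positivity)) ?_
  have hzero := sum_signs_mul_label (z.map fun p => absLoss p f)
  simp only [SignTree.label_map] at hzero
  have : ((∑ ε : Fin n → ℤˣ, 1 / (n : ℝ) *
      ∑ t, ((ε t : ℤ) : ℝ) * absLoss (z.label ε t) f : ℝ) : EReal) = 0 := by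
    rw [← Finset.mul_sum, hzero, mul_zero, EReal.coe_zero]
  rw [← this, coe_sum_ereal]
  exact Finset.sum_le_sum fun ε _ => le_iSup₂_of_le (fun z => absLoss z f) ⟨f, hf, rfl⟩ le_rfl

lemma seqRadTree_le {γ B l η : ℝ} (hγ : 0 < γ) (hl : 0 < l) (hη : 0 < η)
    (hF : F.Nonempty) (hB : ∀ f ∈ F, ∀ x, |f x| ≤ B) {N D : ℕ} (hN : B / (2 * γ) ≤ N)
    (hD : ∀ x : SignTree X D, ¬ GammaShattered γ F x) (hn : 0 < n) (z : SignTree (X × Y) n) :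
    seqRadTree (lossClass (absLoss (X := X) (Y := Y)) F) z ≤
      ((D / l * (Real.log (1 + ((2 * N + 1 : ℕ) : ℝ) * n) / n) + 4 * γ + l * B ^ 2 / 2 + η : ℝ) :
        EReal) := by
  choose φ hφ hle using fun ε => exists_iSup_lossClass_le (F := F) hη hF hB z ε
  have hs := sum_signed_loss_le hγ hl hB hN hD hn z hφ
  refine (mul_le_mul_of_nonneg_left (Finset.sum_le_sum fun ε _ => hle ε)
    (EReal.coe_nonneg.2 (by positivity))).trans ?_
  rw [← coe_sum_ereal, ← EReal.coe_mul, EReal.coe_le_coe_iff, inv_mul_le_iff₀ (by positivity),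
    Finset.sum_add_distrib]
  have hc : ∑ _ε : Fin n → ℤˣ, η = 2 ^ n * η := by simp
  rw [hc]
  linarith

lemma tendsto_log_one_add_mul_div (k : ℕ) :
    Tendsto (fun n : ℕ => Real.log (1 + (k : ℝ) * n) / n) atTop (𝓝 0) := by
  have h1 : Tendsto (fun n : ℕ => Real.log n / (n : ℝ)) atTop (𝓝 0) := by
    have := (Real.isLittleO_log_id_atTop.tendsto_div_nhds_zero).comp tendsto_natCast_atTop_atTop
    exact this
  have h2 : Tendsto (fun n : ℕ => Real.log (1 + k) / (n : ℝ)) atTop (𝓝 0) :=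
    tendsto_const_div_atTop_nhds_zero_nat _
  have h3 := h2.add h1
  rw [add_zero] at h3
  refine tendsto_of_tendsto_of_tendsto_of_le_of_le' tendsto_const_nhds h3 ?_ ?_
  · exact Eventually.of_forall fun n =>
      div_nonneg (Real.log_nonneg (by linarith [show (0 : ℝ) ≤ k * n by positivity]))
        n.cast_nonneg
  · filter_upwards [eventually_ge_atTop 1] with n hn
    have hn' : (1 : ℝ) ≤ n := by exact_mod_cast hn
    rw [← add_div, ← Real.log_mul (by positivity) (by positivity)]
    gcongr
    linarith

lemma eventually_seqRad_le (hbdd : ∃ B : ℝ, ∀ f ∈ F, ∀ x : X, |f x| ≤ B)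
    (hsfat : ∀ γ : ℝ, 0 < γ → sfat γ F < ⊤) {δ : ℝ} (hδ : 0 < δ) :
    ∀ᶠ n : ℕ in atTop, seqRad n (lossClass (absLoss (X := X) (Y := Y)) F) ≤ (δ : EReal) := by
  obtain ⟨B, hB⟩ := hbdd
  -- Over the empty class the inner supremum is `⊥`, so no selector exists but the bound is trivial.
  rcases F.eq_empty_or_nonempty with rfl | hF
  · refine Eventually.of_forall fun n => iSup_le fun z => ?_
    refine le_trans (b := 0) ?_ (EReal.coe_nonneg.2 hδ.le)
    refine (mul_le_mul_of_nonneg_left (b := ∑ ε : Fin n → ℤˣ, ⨆ g ∈ lossClass absLoss ∅, _)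
      (c := 0) ?_ (EReal.coe_nonneg.2 (by positivity))).trans (mul_zero _).le
    refine Finset.sum_nonpos fun ε _ => iSup₂_le ?_
    rintro _ ⟨f, hf, -⟩
    exact hf.elim
  -- With these choices each of the four error terms is at most `δ / 4`.
  set γ := δ / 16 with hγd
  have hγ : 0 < γ := by positivity
  set l := δ / (2 * (B ^ 2 + 1)) with hld
  have hl : 0 < l := by positivity
  obtain ⟨D, hD⟩ := exists_not_gammaShattered (hsfat γ hγ)
  obtain ⟨N, hN⟩ := exists_nat_ge (B / (2 * γ))
  have hlB : l * B ^ 2 / 2 ≤ δ / 4 := by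
    have : l * (B ^ 2 + 1) = δ / 2 := by
      rw [hld]
      field_simp
    nlinarith
  have ht := (tendsto_log_one_add_mul_div (2 * N + 1)).const_mul (D / l)
  rw [mul_zero] at ht
  filter_upwards [ht.eventually_le_const (show 0 < δ / 4 by positivity),
    eventually_gt_atTop 0] with n hn hn0
  refine iSup_le fun z => (seqRadTree_le hγ hl (show 0 < δ / 4 by positivity) hF hB hN hD hn0
    z).trans (EReal.coe_le_coe_iff.2 ?_)
  linarith

end Loss

end SeqLearning

theorem mainTheorem10 {X : Type*} (Y : Set ℝ) (F : Set (X → ℝ))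
    (hbdd : ∃ B : ℝ, ∀ f ∈ F, ∀ x : X, |f x| ≤ B)
    (hsfat : ∀ γ : ℝ, 0 < γ → SeqLearning.sfat γ F < ⊤) :
    limsup (fun n : ℕ => SeqLearning.seqRad n
        (SeqLearning.lossClass (SeqLearning.absLoss (X := X) (Y := Y)) F)) atTop ≤ 0 ∧
    (Nonempty X → Y.Nonempty → F.Nonempty →
      Tendsto (fun n : ℕ => SeqLearning.seqRad n
        (SeqLearning.lossClass (SeqLearning.absLoss (X := X) (Y := Y)) F)) atTop (𝓝 0)) := by
  have hlim : limsup (fun n : ℕ => SeqLearning.seqRad n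
      (SeqLearning.lossClass (SeqLearning.absLoss (X := X) (Y := Y)) F)) atTop ≤ 0 := by
    refine EReal.le_of_forall_lt_iff_le.1 fun δ hδ => ?_
    exact limsup_le_of_le (by isBoundedDefault)
      (SeqLearning.eventually_seqRad_le hbdd hsfat (EReal.coe_pos.1 hδ))
  refine ⟨hlim, fun ⟨x⟩ ⟨y, hy⟩ hF => ?_⟩
  refine tendsto_of_le_liminf_of_limsup_le ?_ hlim
  refine le_liminf_of_le (by isBoundedDefault) (Eventually.of_forall fun n => ?_)
  exact (SeqLearning.seqRadTree_nonneg hF (fun _ _ => (x, ⟨y, hy⟩))).trans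
    (le_iSup (fun z => SeqLearning.seqRadTree _ z) _)
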